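/- Theorem 4.1. Consider $k$ identical stations on a shared channel that proceeds in synchronous rounds. Station $v$ is activated in round $t_v\in\mathbb N$ of a reference clock, and round $t>t_v$ is round $t-t_v$ of its local clock. A non-adaptive randomized algorithm without knowledge of the contention size $k$ is a probability distribution $\mathcal A$, not depending on $k$, over transmission schedules $s:\{1,2,3,\dots\}\to\{0,1\}$; transmissions need not be independent across rounds. Each station independently draws one schedule $s_v$ from $\mathcal A$ and transmits in every round $t>t_v$ with $s_v(t-t_v)=1$, as long as it has not yet transmitted successfully. A station transmits successfully in a round if it is the only station transmitting in that round; it then switches off. The latency of a station is the number of rounds from its activation to its successful transmission ($\infty$ if there is none), and the latency of an execution is the maximum of the latencies of the $k$ stations. An oblivious adversary fixes the activation times $(t_v)$ before the schedules are drawn. Let $\eta>0$. There are no such algorithm $\mathcal A$ and function $\tau:\mathbb N\to\mathbb N$ with $\tau(k)=o\!\left(\frac{k\log k}{(\log\log k)^2}\right)$ as $k\to\infty$ such that, for all sufficiently large $k$ and all activation times of $k$ stations, the latency is at most $\tau(k)$ with probability at least $1-1/k^{\eta}$. Equivalently: for every $\eta>0$, every such $\mathcal A$ and every such $\tau$, there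 are infinitely many $k$ for which an oblivious adversary can choose activation times of $k$ stations so that the latency is at most $\tau(k)$ only with probability less than $1-1/k^{\eta}$. -/

import Mathlib

open Filter Asymptotics MeasureTheory

namespace ContentionResolution

/-- The transmission schedule drawn by one station: `s i = true` means that the station transmits
in round `i` of its local clock, `i = 1, 2, 3, …`, as long as it is switched on. A station is
activated in round `0` of its local clock, and the value `s 0` is never used. -/
abbrev Schedule : Type := ℕ → Bool

/-- A non-adaptive randomized algorithm: a probability distribution over transmission schedules
in local time. The distribution is arbitrary, so transmissions of a station need not be
independent across rounds. It is one and the same for all (anonymous) stations and for all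
contention sizes, so the contention size is unknown to the algorithm. -/
structure NonAdaptiveAlgorithm where
  law : ProbabilityMeasure Schedule

section Execution

variable {ι : Type*}

/-- The stations that transmit in round `t` of the reference clock, when `on` is the set of
stations that have not switched off yet. Station `v` is activated in round `act v` of the
reference clock, so that round `t` is round `t - act v` of its local clock; it follows the
schedule `S v`. -/
def transmitters (act : ι → ℕ) (S : ι → Schedule) (on : Set ι) (t : ℕ) : Set ι :=
  {v | v ∈ on ∧ act v < t ∧ S v (t - act v) = true}

/-- The stations that have not transmitted successfully in any round before `t`. A station
transmits successfully in a round when it is the only transmitter of that round; it then gets the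
acknowledgement and switches off. -/
def notYetSuccessful (act : ι → ℕ) (S : ι → Schedule) : ℕ → Set ι
  | 0 => Set.univ
  | t + 1 =>
      {v | v ∈ notYetSuccessful act S t ∧ transmitters act S (notYetSuccessful act S t) t ≠ {v}}

/-- Station `v` transmits successfully in round `t` of the reference clock. -/
def SucceedsAt (act : ι → ℕ) (S : ι → Schedule) (v : ι) (t : ℕ) : Prop :=
  transmitters act S (notYetSuccessful act S t) t = {v}

/-- The latency of a station: the number of rounds from its activation to its successful
transmission (`⊤` if it never transmits successfully). -/
noncomputable def stationLatency (act : ι → ℕ) (S : ι → Schedule) (v : ι) : ℕ∞ :=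
  ⨅ (t : ℕ) (_ : SucceedsAt act S v t), ((t - act v : ℕ) : ℕ∞)

/-- The latency of an execution: the maximum of the latencies of the participating stations. -/
noncomputable def latency (act : ι → ℕ) (S : ι → Schedule) : ℕ∞ :=
  ⨆ v : ι, stationLatency act S v

end Execution

/-- The probability that the latency of the algorithm `A` is at most `m` when `k` stations are
activated according to `act`; each station draws its schedule independently from the law of `A`.
The wake-up pattern `act` is fixed before the schedules are drawn (oblivious adversary). -/
noncomputable def NonAdaptiveAlgorithm.probLatencyLE (A : NonAdaptiveAlgorithm) {k : ℕ}
    (act : Fin k → ℕ) (m : ℕ) : ℝ :=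
  (Measure.pi (fun _ : Fin k => (A.law : Measure Schedule))).real
    {S : Fin k → Schedule | latency act S ≤ (m : ℕ∞)}

/-- Against every oblivious adversary, the algorithm `A` has latency at most `τ k` with
probability at least `1 - 1 / k ^ η`, for all sufficiently large contention sizes `k`. -/
def NonAdaptiveAlgorithm.HasLatencyWhp (A : NonAdaptiveAlgorithm) (η : ℝ) (τ : ℕ → ℕ) : Prop :=
  ∀ᶠ k : ℕ in atTop, ∀ act : Fin k → ℕ, 1 - 1 / (k : ℝ) ^ η ≤ A.probLatencyLE act (τ k)

end ContentionResolution

/-! An adversary may draw activation times at random, independently of the schedules: a reliability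
bound valid for all fixed times survives averaging (`pi_real_le_of_forall_latency`). Let `r` be the
first local round used with positive probability, and `p` that probability. Two random adversaries
pull in opposite directions.

Few transmissions are fatal. A station whose first transmission falls in its local round `r` cannot
have switched off earlier, so it jams one round that its activation time determines. For contention
`J ^ (8 * j)`, one group of stations blocks the victim's early rounds with probability at least `1 /
2`, and each later transmission is blocked by a group of its own with probability at least `J ^
(-5)`. If the victim made at most `η * J / 5` later transmissions with probability above `1 / 2`,
then all of them would be blocked with probability exceeding the allowed failure probability. So the
expected number of transmissions at this scale is at least `η * J / 10`
(`real_card_pattern_le_mul_le`, `le_sum_transmitsAt_of_reliable`). The `J` scales `J ≤ j < 2 * J`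
occupy disjoint local rounds, and together they give a load of at least `η * J ^ 2 / 10`.

Many transmissions are fatal too. For contention `n = J ^ (16 * J)`, spread the activations over `T`
rounds: the load makes the expected number of transmitters per round of order `J ^ 2 * n / T`. Since
`log n = 16 * J * log J` and `log (log n) ≥ log J`, the assumed bound on `T` makes this a large
multiple of `log T`. A union bound then puts two transmitters in every round after an initial
segment, which is jammed separately, so nobody succeeds by round `T` (`one_sub_le_of_steady_load`,
`not_reliable_of_scale`). -/

namespace ContentionResolution

open ProbabilityTheory

/-! ### Independence and hitting probabilities in product spaces. -/

section Product

variable {ι Ω : Type*}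

lemma exists_measurableSet_preimage_restrict [MeasurableSpace Ω] {E : Set (ι → Ω)} (hE : MeasurableSet E)
    {s : Finset ι} (dE : DependsOn (fun ω => ω ∈ E) (s : Set ι)) :
    ∃ E' : Set (s → Ω), MeasurableSet E' ∧ E = (fun ω (i : s) => ω i) ⁻¹' E' := by
  classical
  rcases E.eq_empty_or_nonempty with rfl | ⟨ω₀, -⟩
  · exact ⟨∅, .empty, by simp⟩
  let g : (s → Ω) → ι → Ω := fun y i => if h : i ∈ s then y ⟨i, h⟩ else ω₀ i
  have hg : Measurable g := by
    refine measurable_pi_lambda _ fun i => ?_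
    by_cases h : i ∈ s
    · simpa [g, h] using measurable_pi_apply (⟨i, h⟩ : s)
    · simp [g, h]
  refine ⟨g ⁻¹' E, hg hE, ?_⟩
  ext ω
  have := @dE ω (g fun i => ω i) (fun i hi => by
    have hi' : i ∈ s := by simpa using hi
    simp [g, hi'])
  simp only [Set.mem_preimage]
  exact Iff.of_eq this

lemma DependsOn.inter_set {E F : Set (ι → Ω)} {s t : Set ι}
    (dE : DependsOn (fun ω => ω ∈ E) s) (dF : DependsOn (fun ω => ω ∈ F) t) :
    DependsOn (fun ω => ω ∈ E ∩ F) (s ∪ t) := by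
  intro x y h
  have h1 := dE (fun i hi => h i (Or.inl hi))
  have h2 := dF (fun i hi => h i (Or.inr hi))
  simp only [Set.mem_inter_iff] at *
  rw [h1, h2]

lemma DependsOn.biInter_set {J : Type*} {E : J → Set (ι → Ω)} {s : J → Set ι} {K : Set J}
    (dE : ∀ j ∈ K, DependsOn (fun ω => ω ∈ E j) (s j)) :
    DependsOn (fun ω => ω ∈ ⋂ j ∈ K, E j) (⋃ j ∈ K, s j) := by
  intro x y h
  simp only [Set.mem_iInter]
  refine propext (forall₂_congr fun j hj => Iff.of_eq (dE j hj fun i hi => h i ?_))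
  simp only [Set.mem_iUnion]
  exact ⟨j, hj, hi⟩

/-- Some coordinate in `s` belongs to `D`. -/
def hits (s : Finset ι) (D : Set Ω) : Set (ι → Ω) := {ω | ∃ u ∈ s, ω u ∈ D}

lemma dependsOn_hits (s : Finset ι) (D : Set Ω) :
    DependsOn (fun ω => ω ∈ hits s D) (s : Set ι) := by
  intro x y h
  simp only [hits, Set.mem_ofPred_eq, eq_iff_iff]
  refine exists_congr fun u => and_congr_right fun hu => ?_
  rw [h u (by simpa using hu)]

lemma measurableSet_hits [MeasurableSpace Ω] (s : Finset ι) {D : Set Ω} (hD : MeasurableSet D) :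
    MeasurableSet (hits s D) := by
  have : hits s D = ⋃ u ∈ s, (fun ω : ι → Ω => ω u) ⁻¹' D := by
    ext; simp [hits]
  rw [this]
  exact s.measurableSet_biUnion fun u _ => measurable_pi_apply u hD

variable [Fintype ι] [MeasurableSpace Ω] (μ : ι → Measure Ω) [∀ i, IsProbabilityMeasure (μ i)]

/-- Events that depend on disjoint sets of coordinates are independent. -/
lemma pi_real_inter_of_dependsOn {E F : Set (ι → Ω)} (hE : MeasurableSet E)
    (hF : MeasurableSet F) {s t : Finset ι} (hst : Disjoint s t)
    (dE : DependsOn (fun ω => ω ∈ E) (s : Set ι)) (dF : DependsOn (fun ω => ω ∈ F) (t : Set ι)) :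
    (Measure.pi μ).real (E ∩ F) = (Measure.pi μ).real E * (Measure.pi μ).real F := by
  obtain ⟨E', hE', rfl⟩ := exists_measurableSet_preimage_restrict hE dE
  obtain ⟨F', hF', rfl⟩ := exists_measurableSet_preimage_restrict hF dF
  have h := (iIndepFun_pi (μ := μ) (X := fun _ ω => ω)
    (fun i => aemeasurable_id)).indepFun_finset s t hst (fun i => measurable_pi_apply i)
  have := h.measure_inter_preimage_eq_mul _ _ hE' hF'
  simp only [measureReal_def]
  rw [this, ENNReal.toReal_mul]

lemma pi_real_biInter_of_dependsOn {J : Type*} {E : J → Set (ι → Ω)} {s : J → Finset ι}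
    (K : Finset J) (hE : ∀ j, MeasurableSet (E j)) (dE : ∀ j, DependsOn (fun ω => ω ∈ E j) (s j : Set ι))
    (hs : ∀ i ∈ K, ∀ j ∈ K, i ≠ j → Disjoint (s i) (s j)) :
    (Measure.pi μ).real (⋂ j ∈ K, E j) = ∏ j ∈ K, (Measure.pi μ).real (E j) := by
  classical
  induction K using Finset.induction_on with
  | empty => simp
  | insert a K ha ih =>
    rw [Finset.prod_insert ha, Finset.set_biInter_insert, ← ih (fun i hi j hj => hs i
      (Finset.mem_insert_of_mem hi) j (Finset.mem_insert_of_mem hj))]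
    have hd : DependsOn (fun ω => ω ∈ ⋂ j ∈ K, E j) ((K.biUnion s : Finset ι) : Set ι) := by
      have := DependsOn.biInter_set (E := E) (s := fun j => (s j : Set ι)) (K := (K : Set J))
        (fun j _ => dE j)
      simpa using this
    refine pi_real_inter_of_dependsOn μ (hE a) (K.measurableSet_biInter fun j _ => hE j)
      ?_ (dE a) hd
    rw [Finset.disjoint_biUnion_right]
    intro j hj
    exact hs a (Finset.mem_insert_self _ _) j (Finset.mem_insert_of_mem hj)
      (by rintro rfl; exact ha hj)

lemma pi_real_compl_hits_le (s : Finset ι) {D : Set Ω} (hD : MeasurableSet D) {q : ℝ}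
    (hq : ∀ u ∈ s, q ≤ (μ u).real D) :
    (Measure.pi μ).real (hits s D)ᶜ ≤ Real.exp (-(q * s.card)) := by
  classical
  have h1 : (hits s D)ᶜ = Set.pi Set.univ (fun u => if u ∈ s then Dᶜ else Set.univ) := by
    ext ω
    simp only [hits, Set.mem_compl_iff, Set.mem_ofPred_eq, Set.mem_pi, Set.mem_univ, true_imp_iff]
    push Not
    refine forall_congr' fun u => ?_
    split_ifs with h <;> simp [h]
  rw [measureReal_def, h1, Measure.pi_pi, ENNReal.toReal_prod]
  have h2 : ∀ u, (μ u (if u ∈ s then Dᶜ else Set.univ)).toReal =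
      if u ∈ s then 1 - (μ u).real D else 1 := by
    intro u
    split_ifs
    · exact probReal_compl_eq_one_sub hD
    · simp
  simp only [h2]
  rw [Finset.prod_ite_mem, Finset.univ_inter]
  calc ∏ u ∈ s, (1 - (μ u).real D) ≤ ∏ u ∈ s, Real.exp (-q) := by
        refine Finset.prod_le_prod (fun u _ => by linarith [measureReal_le_one (μ := μ u) (s := D)])
          fun u hu => ?_
        have := Real.add_one_le_exp (-q)
        linarith [hq u hu]
    _ = Real.exp (-(q * s.card)) := by
        rw [Finset.prod_const, ← Real.exp_nat_mul]
        congr 1; ring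

end Product

/-! ### From fixed to random activation times. -/

section Transfer

/-- A lower bound on the reliability that holds for all activation times bounds the probability
of a long latency when the activation times are random and independent as well. -/
lemma pi_real_le_of_forall_latency {A : NonAdaptiveAlgorithm} {n M : ℕ} {δ : ℝ}
    (hA : ∀ act : Fin n → ℕ, 1 - δ ≤ A.probLatencyLE act M)
    (U : Fin n → Measure ℕ) [∀ u, IsProbabilityMeasure (U u)]
    {E : Set (Fin n → ℕ × Schedule)} (hE : MeasurableSet E)
    (hlat : ∀ ω ∈ E, (M : ℕ∞) < latency (fun u => (ω u).1) (fun u => (ω u).2)) :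
    (Measure.pi fun u => (U u).prod (A.law : Measure Schedule)).real E ≤ δ := by
  have hmp := measurePreserving_arrowProdEquivProdArrow ℕ Schedule (Fin n) U
    (fun _ => (A.law : Measure Schedule))
  set e := MeasurableEquiv.arrowProdEquivProdArrow ℕ Schedule (Fin n)
  have h1 : (Measure.pi fun u => (U u).prod (A.law : Measure Schedule)) E =
      ((Measure.pi U).prod (Measure.pi fun _ : Fin n => (A.law : Measure Schedule)))
        (e.symm ⁻¹' E) := by
    rw [← hmp.measure_preimage (e.symm.measurable hE).nullMeasurableSet, ← Set.preimage_comp]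
    simp
  have hE' : MeasurableSet (e.symm ⁻¹' E) := e.symm.measurable hE
  -- By Fubini it suffices to bound each fibre over fixed activation times; such a fibre misses the
  -- event of small latency.
  have h2 : ∀ act : Fin n → ℕ, (Measure.pi fun _ : Fin n => (A.law : Measure Schedule))
      (Prod.mk act ⁻¹' (e.symm ⁻¹' E)) ≤ ENNReal.ofReal δ := by
    intro act
    have hm : MeasurableSet (Prod.mk act ⁻¹' (e.symm ⁻¹' E)) := measurable_prodMk_left hE'
    rw [← ofReal_measureReal]
    apply ENNReal.ofReal_le_ofReal
    have h3 := hA act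
    have h4 : A.probLatencyLE act M ≤ (Measure.pi fun _ : Fin n => (A.law : Measure Schedule)).real
        (Prod.mk act ⁻¹' (e.symm ⁻¹' E))ᶜ := by
      refine measureReal_mono (fun S hS hmem => ?_)
      have := hlat _ hmem
      exact absurd hS (not_le.mpr this)
    rw [probReal_compl_eq_one_sub hm] at h4
    linarith
  have hδ : 0 ≤ δ := by
    have := hA 0
    linarith [show A.probLatencyLE (0 : Fin n → ℕ) M ≤ 1 from measureReal_le_one]
  rw [measureReal_def, h1, Measure.prod_apply hE']
  refine ENNReal.toReal_le_of_le_ofReal hδ ?_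
  calc _ ≤ ∫⁻ _, ENNReal.ofReal δ ∂(Measure.pi U) := lintegral_mono h2
    _ = _ := by simp

end Transfer

/-! ### Jamming patterns that force a long latency. -/

section Deterministic

variable {ι : Type*} {act : ι → ℕ} {S : ι → Schedule}

lemma lt_latency_of_forall_not_succeedsAt {v : ι} {m : ℕ}
    (h : ∀ t, act v < t → t ≤ act v + m → ¬ SucceedsAt act S v t) :
    (m : ℕ∞) < latency act S := by
  have h1 : ((m + 1 : ℕ) : ℕ∞) ≤ stationLatency act S v := by
    refine le_iInf₂ fun t ht => ?_
    have hlt : act v < t := by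
      have : v ∈ transmitters act S (notYetSuccessful act S t) t := by
        rw [show transmitters act S (notYetSuccessful act S t) t = {v} from ht]; rfl
      exact this.2.1
    by_contra! hcon
    exact h t hlt (by have := Nat.cast_lt.mp hcon; omega) ht
  calc (m : ℕ∞) < ((m + 1 : ℕ) : ℕ∞) := by exact_mod_cast Nat.lt_succ_self m
    _ ≤ stationLatency act S v := h1
    _ ≤ latency act S := le_iSup (stationLatency act S) v

/-- Only a transmitter can switch off. Hence a first transmission always takes place, whatever the
other stations did before. -/
lemma mem_notYetSuccessful_of_silent {u : ι} {t : ℕ}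
    (h : ∀ t' < t, act u < t' → S u (t' - act u) = false) : u ∈ notYetSuccessful act S t := by
  induction t with
  | zero => exact Set.mem_univ u
  | succ t ih =>
    refine ⟨ih fun t' ht' => h t' (by omega), fun hu => ?_⟩
    have : u ∈ transmitters act S (notYetSuccessful act S t) t := by rw [hu]; rfl
    have h1 := h t (by omega) this.2.1
    rw [this.2.2] at h1
    exact Bool.noConfusion h1

/-- A station fails as long as each of its transmissions coincides with the first transmission of
some other station. -/
lemma lt_latency_of_fresh_collisions {v : ι} {m r : ℕ} (hr : 1 ≤ r) (hv : act v = r)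
    (h : ∀ i, 1 ≤ i → i ≤ m → S v i = true → ∃ u, u ≠ v ∧ act u = i ∧ S u r = true ∧
      ∀ j, 1 ≤ j → j < r → S u j = false) :
    (m : ℕ∞) < latency act S := by
  refine lt_latency_of_forall_not_succeedsAt (v := v) fun t ht htm hs => ?_
  have hmem : v ∈ transmitters act S (notYetSuccessful act S t) t := by
    rw [show transmitters act S (notYetSuccessful act S t) t = {v} from hs]; rfl
  obtain ⟨u, huv, hu, hur, huf⟩ := h (t - act v) (by omega) (by omega) hmem.2.2
  have hut : t - act u = r := by omega
  have : u ∈ transmitters act S (notYetSuccessful act S t) t := by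
    refine ⟨mem_notYetSuccessful_of_silent fun t' ht' hat => huf _ (by omega) (by omega),
      by omega, by rw [hut]; exact hur⟩
  rw [show transmitters act S (notYetSuccessful act S t) t = {v} from hs] at this
  exact huv this

/-- If no round has exactly one transmitter when stations are never switched off, then there is
no success at all. -/
lemma lt_latency_of_no_singleton {v : ι} {m : ℕ} (hv : act v = 0)
    (h : ∀ t, 1 ≤ t → t ≤ m → ∀ w, transmitters act S Set.univ t ≠ {w}) :
    (m : ℕ∞) < latency act S := by
  have key : ∀ t ≤ m + 1, notYetSuccessful act S t = Set.univ := by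
    intro t
    induction t with
    | zero => intro _; rfl
    | succ t ih =>
      intro ht
      have ih' := ih (by omega)
      refine Set.eq_univ_of_forall fun w => ⟨by rw [ih']; exact Set.mem_univ w, ?_⟩
      rw [ih']
      -- Round `0` has no transmitters, since activation strictly precedes transmission.
      rcases Nat.eq_zero_or_pos t with rfl | hpos
      · intro hw
        have : w ∈ transmitters act S Set.univ 0 := by rw [hw]; rfl
        exact absurd this.2.1 (by omega)
      · exact h t hpos (by omega) w
  refine lt_latency_of_forall_not_succeedsAt (v := v) fun t ht htm hs => ?_
  have hs' : transmitters act S (notYetSuccessful act S t) t = {v} := hs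
  rw [key t (by omega)] at hs'
  exact h t (by omega) (by omega) v hs'

end Deterministic

/-! ### Events for a single station and their probabilities. -/

section Events

/-- The schedules with a transmission in local round `i`. -/
def transmitsAt (i : ℕ) : Set Schedule := {s | s i = true}

/-- The schedules whose first transmission is in local round `r`. -/
def firstAt (r : ℕ) : Set Schedule := {s | s r = true ∧ ∀ j, 1 ≤ j → j < r → s j = false}

/-- A station activated in round `i` whose first transmission is in its local round `r`. -/
def freshAt (r i : ℕ) : Set (ℕ × Schedule) := {i} ×ˢ firstAt r

/-- A station that is scheduled to transmit in round `t` of the reference clock. -/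
def scheduledAt (t : ℕ) : Set (ℕ × Schedule) := {z | z.1 < t ∧ z.2 (t - z.1) = true}

lemma measurableSet_transmitsAt (i : ℕ) : MeasurableSet (transmitsAt i) :=
  measurableSet_preimage (f := fun s : Schedule => s i) (measurable_pi_apply i)
    (MeasurableSet.singleton true)

lemma measurableSet_silentAt (i : ℕ) : MeasurableSet {s : Schedule | s i = false} :=
  measurableSet_preimage (f := fun s : Schedule => s i) (measurable_pi_apply i)
    (MeasurableSet.singleton false)

lemma measurableSet_firstAt (r : ℕ) : MeasurableSet (firstAt r) := by
  have : firstAt r = transmitsAt r ∩ ⋂ j, ⋂ (_ : 1 ≤ j), ⋂ (_ : j < r),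
      {s : Schedule | s j = false} := by
    ext s; simp [firstAt, transmitsAt]
  rw [this]
  exact (measurableSet_transmitsAt r).inter (MeasurableSet.iInter fun j => MeasurableSet.iInter
    fun _ => MeasurableSet.iInter fun _ => measurableSet_silentAt j)

lemma measurableSet_freshAt (r i : ℕ) : MeasurableSet (freshAt r i) :=
  (MeasurableSet.singleton i).prod (measurableSet_firstAt r)

/-- Splitting by activation round yields finitely many disjoint rectangles, hence both measurability
and the convolution formula for the probability. -/
lemma scheduledAt_eq (t : ℕ) :
    scheduledAt t = ⋃ a ∈ Finset.range t, ({a} : Set ℕ) ×ˢ transmitsAt (t - a) := by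
  ext ⟨a, s⟩
  simp only [scheduledAt, transmitsAt, Set.mem_ofPred_eq, Set.mem_iUnion, Finset.mem_range,
    Set.mem_prod, Set.mem_singleton_iff]
  constructor
  · rintro ⟨h1, h2⟩
    exact ⟨a, h1, rfl, h2⟩
  · rintro ⟨b, h1, rfl, h2⟩
    exact ⟨h1, h2⟩

lemma measurableSet_scheduledAt (t : ℕ) : MeasurableSet (scheduledAt t) := by
  rw [scheduledAt_eq]
  exact Finset.measurableSet_biUnion _ fun a _ =>
    (MeasurableSet.singleton a).prod (measurableSet_transmitsAt _)

variable (U : Measure ℕ) (ν : Measure Schedule) [IsProbabilityMeasure ν]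

lemma prod_real_freshAt (r i : ℕ) :
    (U.prod ν).real (freshAt r i) = U.real {i} * ν.real (firstAt r) :=
  measureReal_prod_prod _ _

lemma prod_real_scheduledAt [IsProbabilityMeasure U] (t : ℕ) :
    (U.prod ν).real (scheduledAt t) =
      ∑ a ∈ Finset.range t, U.real {a} * ν.real (transmitsAt (t - a)) := by
  rw [scheduledAt_eq, measureReal_biUnion_finset]
  · exact Finset.sum_congr rfl fun a _ => measureReal_prod_prod _ _
  · intro a _ b _ hab
    exact Set.disjoint_prod.mpr (Or.inl (by simpa using hab))
  · exact fun a _ => (MeasurableSet.singleton a).prod (measurableSet_transmitsAt _)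

lemma uniformOn_real_singleton {s : Finset ℕ} {i : ℕ} (hi : i ∈ s) :
    (uniformOn (s : Set ℕ)).real {i} = 1 / (s.card : ℝ) := by
  have : (uniformOn (s : Set ℕ)) (({i} : Finset ℕ) : Set ℕ) = _ := uniformOn_apply_finset
  rw [Finset.inter_singleton_of_mem hi] at this
  rw [measureReal_def]
  simp only [Finset.coe_singleton] at this
  rw [this]
  simp

/-- Earlier transmissions form a null event, so `p` also measures the stations that can serve as
fresh jammers. -/
lemma real_firstAt_eq {r : ℕ} (h : ∀ j, 1 ≤ j → j < r → ν.real (transmitsAt j) = 0) :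
    ν.real (firstAt r) = ν.real (transmitsAt r) := by
  have h0 : ∀ᵐ s ∂ν, ∀ j, 1 ≤ j → j < r → s j = false := by
    rw [ae_all_iff]
    intro j
    by_cases hj : 1 ≤ j ∧ j < r
    · have h1 := h j hj.1 hj.2
      rw [measureReal_eq_zero_iff] at h1
      filter_upwards [measure_eq_zero_iff_ae_notMem.mp h1] with s hs _ _
      simpa [transmitsAt] using hs
    · exact Eventually.of_forall fun s h1 h2 => absurd ⟨h1, h2⟩ hj
  refine measureReal_congr ?_
  filter_upwards [h0] with s hs
  exact propext ⟨fun h => h.1, fun h => ⟨h, hs⟩⟩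

end Events

/-! ### Disjoint groups of stations and their activation laws. -/

/-- The extra point `none` is a distinguished station, whose failure the adversary aims at. -/
lemma exists_embedding_groups {Γ : Type*} [Fintype Γ] {m n : ℕ}
    (h : Fintype.card Γ * m + 1 ≤ n) : Nonempty (Option (Γ × Fin m) ↪ Fin n) :=
  Function.Embedding.nonempty_of_card_le (by simpa using h)

/-- The stations of one group of the adversary. -/
def group {Γ : Type*} {m n : ℕ} (e : Option (Γ × Fin m) ↪ Fin n) (g : Γ) : Finset (Fin n) :=
  Finset.univ.map ⟨fun k : Fin m => e (some (g, k)), fun a b h => by simpa using h⟩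

section Group

variable {Γ : Type*} {m n : ℕ} (e : Option (Γ × Fin m) ↪ Fin n)

lemma card_group (g : Γ) : (group e g).card = m := by simp [group]

lemma mem_group {g : Γ} {u : Fin n} : u ∈ group e g ↔ ∃ k, e (some (g, k)) = u := by
  simp only [group, Finset.mem_map, Finset.mem_univ, true_and]
  rfl

lemma disjoint_group {g g' : Γ} (h : g ≠ g') : Disjoint (group e g) (group e g') := by
  rw [Finset.disjoint_left]
  intro u hu hu'
  obtain ⟨k, rfl⟩ := (mem_group e).1 hu
  obtain ⟨k', hk⟩ := (mem_group e).1 hu'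
  have := e.injective hk
  simp only [Option.some.injEq, Prod.mk.injEq] at this
  exact h this.1.symm

lemma none_notMem_group (g : Γ) : e none ∉ group e g := by
  intro h
  obtain ⟨k, hk⟩ := (mem_group e).1 h
  exact absurd (e.injective hk) (by simp)

/-- The laws of the activation times: one station is activated in round `a`, and the stations of
group `g` are activated in a round drawn from `L g`. -/
noncomputable def activationLaw (a : ℕ) (L : Γ → Measure ℕ) : Fin n → Measure ℕ :=
  -- Leftover stations start in round `0`; this is harmless, because additional transmitters never
  -- undo a collision.
  Function.extend e (fun o => o.elim (Measure.dirac a) fun p => L p.1) fun _ => Measure.dirac 0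

instance (a : ℕ) (L : Γ → Measure ℕ) [hL : ∀ g, IsProbabilityMeasure (L g)] (u : Fin n) :
    IsProbabilityMeasure (activationLaw e a L u) := by
  by_cases h : ∃ o, e o = u
  · obtain ⟨o, rfl⟩ := h
    rw [activationLaw, e.injective.extend_apply]
    cases o with
    | none => exact Measure.dirac.isProbabilityMeasure
    | some p => exact hL p.1
  · rw [activationLaw, Function.extend_apply' _ _ _ h]
    exact Measure.dirac.isProbabilityMeasure

lemma activationLaw_none (a : ℕ) (L : Γ → Measure ℕ) :
    activationLaw e a L (e none) = Measure.dirac a := by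
  rw [activationLaw, e.injective.extend_apply]; rfl

lemma activationLaw_group (a : ℕ) (L : Γ → Measure ℕ) {g : Γ} {u : Fin n} (hu : u ∈ group e g) :
    activationLaw e a L u = L g := by
  obtain ⟨k, rfl⟩ := (mem_group e).1 hu
  rw [activationLaw, e.injective.extend_apply]; rfl

end Group

instance (s : Finset ℕ) [h : Fact s.Nonempty] : IsProbabilityMeasure (uniformOn (s : Set ℕ)) :=
  isProbabilityMeasure_uniformOn s.finite_toSet (by simpa using h.out)

/-! ### A station with few transmissions can be jammed. -/

/-- The local rounds in `(a, b]` in which the schedule `s` transmits. -/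
def pattern (a b : ℕ) (s : Schedule) : Finset ℕ := (Finset.Ioc a b).filter fun i => s i = true

lemma measurableSet_pattern_eq (a b : ℕ) (W : Finset ℕ) :
    MeasurableSet {s : Schedule | pattern a b s = W} := by
  have : {s : Schedule | pattern a b s = W} = ⋂ i : ℕ,
      {s : Schedule | i ∈ pattern a b s ↔ i ∈ W} := by
    ext s
    simp [Finset.ext_iff]
  rw [this]
  refine MeasurableSet.iInter fun i => ?_
  have h2 : {s : Schedule | i ∈ pattern a b s ↔ i ∈ W} =
      (fun s : Schedule => s i) ⁻¹' {c | (i ∈ Finset.Ioc a b ∧ c = true) ↔ i ∈ W} := by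
    ext s
    simp [pattern]
  rw [h2]
  exact measurable_pi_apply i (MeasurableSet.of_discrete)

lemma measurableSet_card_pattern_le (a b x : ℕ) :
    MeasurableSet {s : Schedule | (pattern a b s).card ≤ x} := by
  have : {s : Schedule | (pattern a b s).card ≤ x} =
      ⋃ W ∈ (Finset.Ioc a b).powerset.filter (fun W => W.card ≤ x),
        {s : Schedule | pattern a b s = W} := by
    ext s
    simp only [Set.mem_ofPred_eq, Set.mem_iUnion, Finset.mem_filter, Finset.mem_powerset]
    exact ⟨fun h => ⟨_, ⟨Finset.filter_subset _ _, h⟩, rfl⟩, fun ⟨W, ⟨_, h⟩, hW⟩ => hW ▸ h⟩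
  rw [this]
  exact Finset.measurableSet_biUnion _ fun W _ => measurableSet_pattern_eq a b W

lemma real_card_pattern_le (ν : Measure Schedule) [IsProbabilityMeasure ν] (a b x : ℕ) :
    ν.real {s | (pattern a b s).card ≤ x} =
      ∑ W ∈ (Finset.Ioc a b).powerset.filter (fun W => W.card ≤ x),
        ν.real {s | pattern a b s = W} := by
  rw [← measureReal_biUnion_finset]
  · congr 1
    ext s
    simp only [Set.mem_ofPred_eq, Set.mem_iUnion, Finset.mem_filter, Finset.mem_powerset]
    exact ⟨fun h => ⟨_, ⟨Finset.filter_subset _ _, h⟩, rfl⟩, fun ⟨W, ⟨_, h⟩, hW⟩ => hW ▸ h⟩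
  · intro W _ W' _ h
    exact Set.disjoint_left.mpr fun s hs hs' => h (hs.symm.trans hs')
  · exact fun W _ => measurableSet_pattern_eq a b W

/-- If a station transmits at most `x` times in the local rounds `(a, b]`, then the adversary
prevents its success by `x + 1` groups of `m` stations: one group is spread over the first `a`
rounds, and each other group, spread over `b` rounds, has to jam one transmission only. -/
lemma real_card_pattern_le_mul_le (A : NonAdaptiveAlgorithm) {n m a b x r : ℕ} {δ : ℝ}
    (hr : 1 ≤ r) (ha : 1 ≤ a) (hb : 1 ≤ b) (hn : (x + 1) * m + 1 ≤ n)
    (hA : ∀ act : Fin n → ℕ, 1 - δ ≤ A.probLatencyLE act b) :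
    (A.law : Measure Schedule).real {s | (pattern a b s).card ≤ x} *
      (1 - a * Real.exp (-((1 / a * (A.law : Measure Schedule).real (firstAt r)) * m))) *
      (1 - Real.exp (-((1 / b * (A.law : Measure Schedule).real (firstAt r)) * m))) ^ x ≤ δ := by
  classical
  set ν : Measure Schedule := (A.law : Measure Schedule) with hν
  set p := ν.real (firstAt r)
  obtain ⟨e⟩ := exists_embedding_groups (Γ := Option (Fin x)) (m := m) (n := n) (by simpa using hn)
  have fa : Fact (Finset.Icc 1 a).Nonempty := ⟨by simpa using ha⟩
  have fb : Fact (Finset.Icc 1 b).Nonempty := ⟨by simpa using hb⟩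
  let L : Option (Fin x) → Measure ℕ := fun o =>
    o.elim (uniformOn (Finset.Icc 1 a : Finset ℕ)) fun _ => uniformOn (Finset.Icc 1 b : Finset ℕ)
  have hL : ∀ g, IsProbabilityMeasure (L g) := by
    rintro (_ | g)
    · exact inferInstanceAs (IsProbabilityMeasure (uniformOn ((Finset.Icc 1 a : Finset ℕ) : Set ℕ)))
    · exact inferInstanceAs (IsProbabilityMeasure (uniformOn ((Finset.Icc 1 b : Finset ℕ) : Set ℕ)))
  -- The victim starts in round `r`, so its local round `i` is the local round `r` of a station
  -- activated in round `i`.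
  let U := activationLaw e r L
  have hU : ∀ u, IsProbabilityMeasure (U u) := fun u =>
    inferInstanceAs (IsProbabilityMeasure (activationLaw e r L u))
  let μ : Fin n → Measure (ℕ × Schedule) := fun u => (U u).prod ν
  set P := Measure.pi μ with hP
  -- the early jam
  let EA : Set (Fin n → ℕ × Schedule) := ⋂ i ∈ Finset.Icc 1 a, hits (group e none) (freshAt r i)
  have mEA : MeasurableSet EA := Finset.measurableSet_biInter _ fun i _ =>
    measurableSet_hits _ (measurableSet_freshAt r i)
  have dEA : DependsOn (fun ω => ω ∈ EA) (group e none : Set (Fin n)) := by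
    have := DependsOn.biInter_set (E := fun i => hits (group e none) (freshAt r i))
      (s := fun _ => (group e none : Set (Fin n))) (K := (Finset.Icc 1 a : Set ℕ))
      (fun i _ => dependsOn_hits _ _)
    have h2 : DependsOn (fun ω => ω ∈ EA) (⋃ i ∈ (Finset.Icc 1 a : Set ℕ),
        (group e none : Set (Fin n))) := by simpa [EA] using this
    refine h2.mono ?_
    exact Set.iUnion₂_subset fun _ _ => subset_rfl
  have pEA : 1 - a * Real.exp (-((1 / a * p) * m)) ≤ P.real EA := by
    have h1 : P.real EAᶜ ≤ ∑ i ∈ Finset.Icc 1 a, P.real (hits (group e none) (freshAt r i))ᶜ := by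
      have : EAᶜ = ⋃ i ∈ Finset.Icc 1 a, (hits (group e none) (freshAt r i))ᶜ := by
        simp [EA, Set.compl_iInter]
      rw [this]
      exact measureReal_biUnion_finset_le _ _
    have h2 : ∀ i ∈ Finset.Icc 1 a, P.real (hits (group e none) (freshAt r i))ᶜ ≤
        Real.exp (-((1 / a * p) * m)) := by
      intro i hi
      have := pi_real_compl_hits_le μ (group e none) (measurableSet_freshAt r i) (q := 1 / a * p)
        (fun u hu => by
          simp only [μ, prod_real_freshAt]
          rw [show U u = L none from activationLaw_group e r L hu]
          simp only [L, Option.elim]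
          rw [uniformOn_real_singleton hi]
          simp [p])
      rwa [card_group] at this
    have h3 := Finset.sum_le_sum h2
    rw [Finset.sum_const, nsmul_eq_mul, Nat.card_Icc] at h3
    rw [probReal_compl_eq_one_sub mEA] at h1
    simp only [Nat.add_sub_cancel] at h3
    linarith
  -- the jam of one late transmission
  set β := 1 - Real.exp (-((1 / b * p) * m)) with hβ
  have hβ0 : 0 ≤ β := by
    have : 0 ≤ 1 / b * p * m := by positivity
    rw [hβ, sub_nonneg]
    exact Real.exp_le_one_iff.mpr (by linarith)
  have hβ1 : β ≤ 1 := by rw [hβ]; linarith [Real.exp_pos (-((1 / b * p) * m))]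
  have pB : ∀ g : Fin x, ∀ i ∈ Finset.Icc 1 b,
      β ≤ P.real (hits (group e (some g)) (freshAt r i)) := by
    intro g i hi
    have := pi_real_compl_hits_le μ (group e (some g)) (measurableSet_freshAt r i) (q := 1 / b * p)
      (fun u hu => by
        simp only [μ, prod_real_freshAt]
        rw [show U u = L (some g) from activationLaw_group e r L hu]
        simp only [L, Option.elim]
        rw [uniformOn_real_singleton hi]
        simp [p])
    rw [card_group, probReal_compl_eq_one_sub
      (measurableSet_hits _ (measurableSet_freshAt r i))] at this
    linarith
  set 𝒲 := (Finset.Ioc a b).powerset.filter (fun W => W.card ≤ x) with h𝒲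
  have hB : ∀ W ∈ 𝒲, ∃ EB : Set (Fin n → ℕ × Schedule), MeasurableSet EB ∧
      DependsOn (fun ω => ω ∈ EB)
        ((Finset.univ.biUnion fun g => group e (some g) : Finset (Fin n)) : Set (Fin n)) ∧
      β ^ x ≤ P.real EB ∧
      ∀ ω ∈ EB, ∀ i ∈ W, ∃ g, ω ∈ hits (group e (some g)) (freshAt r i) := by
    intro W hW
    obtain ⟨hWab, hWx⟩ := Finset.mem_filter.1 hW
    rw [Finset.mem_powerset] at hWab
    -- Each transmission in `W` gets its own group; disjointness of the groups makes the jams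
    -- independent.
    obtain ⟨f⟩ : Nonempty (W ↪ Fin x) := Function.Embedding.nonempty_of_card_le (by simpa using hWx)
    have hmeas : ∀ i : W, MeasurableSet (hits (group e (some (f i))) (freshAt r i)) := fun i =>
      measurableSet_hits _ (measurableSet_freshAt r i)
    refine ⟨⋂ i ∈ (Finset.univ : Finset W), hits (group e (some (f i))) (freshAt r i),
      Finset.measurableSet_biInter _ fun i _ => hmeas i, ?_, ?_, ?_⟩
    · have := DependsOn.biInter_set (E := fun i : W => hits (group e (some (f i))) (freshAt r i))
        (s := fun i => (group e (some (f i)) : Set (Fin n)))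
        (K := ((Finset.univ : Finset W) : Set W)) (fun i _ => dependsOn_hits _ _)
      have h2 : DependsOn (fun ω => ω ∈ ⋂ i ∈ (Finset.univ : Finset W),
          hits (group e (some (f i))) (freshAt r i)) (⋃ i ∈ ((Finset.univ : Finset W) : Set W),
            (group e (some (f i)) : Set (Fin n))) := by
        simpa only [Finset.mem_coe] using this
      refine h2.mono (Set.iUnion₂_subset fun i _ u hu => ?_)
      simp only [Finset.coe_biUnion, Set.mem_iUnion]
      exact ⟨f i, by simp, hu⟩
    · rw [pi_real_biInter_of_dependsOn μ (s := fun i : W => group e (some (f i))) _ hmeas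
        (fun i => dependsOn_hits _ _)
        (fun i _ j _ hij => disjoint_group e fun h =>
          hij (f.injective (Option.some_injective _ h)))]
      calc β ^ x ≤ β ^ W.card := pow_le_pow_of_le_one hβ0 hβ1 hWx
        _ = ∏ i ∈ (Finset.univ : Finset W), β := by simp
        _ ≤ _ := Finset.prod_le_prod (fun _ _ => hβ0) fun i _ => pB (f i) i (by
            have := Finset.mem_Ioc.1 (hWab i.2)
            exact Finset.mem_Icc.2 ⟨by omega, this.2⟩)
    · intro ω hω i hi
      simp only [Finset.mem_univ, Set.iInter_true, Set.mem_iInter] at hω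
      exact ⟨f ⟨i, hi⟩, hω ⟨i, hi⟩⟩
  choose! EB mEB dEB pEB hEB using hB
  let EV : Finset ℕ → Set (Fin n → ℕ × Schedule) := fun W =>
    {ω | ω (e none) ∈ ({r} : Set ℕ) ×ˢ {s : Schedule | pattern a b s = W}}
  have mEV : ∀ W, MeasurableSet (EV W) := fun W =>
    measurableSet_preimage (measurable_pi_apply (e none))
      ((MeasurableSet.singleton r).prod (measurableSet_pattern_eq a b W))
  have dEV : ∀ W, DependsOn (fun ω => ω ∈ EV W) (({e none} : Finset (Fin n)) : Set (Fin n)) := by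
    intro W ω ω' h
    have := h (e none) (by simp)
    simp only [EV, Set.mem_ofPred_eq, this]
  have pEV : ∀ W, P.real (EV W) = ν.real {s | pattern a b s = W} := by
    intro W
    have h1 : P.real (EV W) = (μ (e none)).real (({r} : Set ℕ) ×ˢ {s | pattern a b s = W}) := by
      simp only [measureReal_def]
      rw [← (measurePreserving_eval μ (e none)).measure_preimage
        ((MeasurableSet.singleton r).prod (measurableSet_pattern_eq a b W)).nullMeasurableSet]
      rfl
    rw [h1]
    simp only [μ]
    rw [show U (e none) = Measure.dirac r from activationLaw_none e r L, measureReal_prod_prod]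
    simp [measureReal_def]
  -- The required jam depends on the victim's pattern `W`, but for fixed `W` it concerns other
  -- stations only, so probabilities multiply. Different patterns give disjoint events, so the
  -- products add up.
  let E : Finset ℕ → Set (Fin n → ℕ × Schedule) := fun W => EV W ∩ (EA ∩ EB W)
  have mE : ∀ W ∈ 𝒲, MeasurableSet (E W) := fun W hW => (mEV W).inter (mEA.inter (mEB W hW))
  have pE : ∀ W ∈ 𝒲, ν.real {s | pattern a b s = W} *
      ((1 - a * Real.exp (-((1 / a * p) * m))) * β ^ x) ≤ P.real (E W) := by
    intro W hW
    have hdis : Disjoint (group e none)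
        (Finset.univ.biUnion fun g => group e (some g) : Finset (Fin n)) := by
      rw [Finset.disjoint_biUnion_right]
      exact fun g _ => disjoint_group e (by simp)
    have h1 : P.real (EA ∩ EB W) = P.real EA * P.real (EB W) :=
      pi_real_inter_of_dependsOn μ mEA (mEB W hW) hdis dEA (dEB W hW)
    have d2 : DependsOn (fun ω => ω ∈ EA ∩ EB W) ((group e none ∪
        Finset.univ.biUnion fun g => group e (some g) : Finset (Fin n)) : Set (Fin n)) := by
      rw [Finset.coe_union]
      exact DependsOn.inter_set dEA (dEB W hW)
    have h2 : P.real (E W) = P.real (EV W) * P.real (EA ∩ EB W) := by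
      refine pi_real_inter_of_dependsOn μ (mEV W) (mEA.inter (mEB W hW)) ?_ (dEV W) d2
      rw [Finset.disjoint_singleton_left, Finset.mem_union, Finset.mem_biUnion]
      rintro (h | ⟨g, -, h⟩)
      · exact none_notMem_group e _ h
      · exact none_notMem_group e _ h
    rw [h2, h1, pEV]
    gcongr
    exact pEB W hW
  have hfin : P.real (⋃ W ∈ 𝒲, E W) ≤ δ := by
    refine pi_real_le_of_forall_latency hA U (Finset.measurableSet_biUnion _ mE) ?_
    intro ω hω
    simp only [Set.mem_iUnion] at hω
    obtain ⟨W, hW, ⟨hv, hpat⟩, hωA, hωB⟩ := hω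
    have hv' : (ω (e none)).1 = r := hv
    have hpat' : pattern a b (ω (e none)).2 = W := hpat
    refine lt_latency_of_fresh_collisions (v := e none) hr hv' fun i hi1 hib hi => ?_
    have key : ∀ g, ω ∈ hits (group e g) (freshAt r i) → ∃ u, u ≠ e none ∧ (ω u).1 = i ∧
        (ω u).2 r = true ∧ ∀ j, 1 ≤ j → j < r → (ω u).2 j = false := by
      rintro g ⟨u, hu, hu1, hu2⟩
      exact ⟨u, fun h => none_notMem_group e g (h ▸ hu), hu1, hu2.1, hu2.2⟩
    by_cases hia : i ≤ a
    · simp only [EA, Set.mem_iInter] at hωA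
      exact key _ (hωA i (Finset.mem_Icc.2 ⟨hi1, hia⟩))
    · have hiW : i ∈ W := by
        rw [← hpat']
        exact Finset.mem_filter.2 ⟨Finset.mem_Ioc.2 ⟨by omega, hib⟩, hi⟩
      obtain ⟨g, hg⟩ := hEB W hW ω hωB i hiW
      exact key _ hg
  rw [measureReal_biUnion_finset ?_ mE] at hfin
  · refine le_trans ?_ hfin
    rw [real_card_pattern_le, mul_assoc, Finset.sum_mul]
    exact Finset.sum_le_sum pE
  · intro W _ W' _ h
    refine Set.disjoint_left.mpr fun ω hω hω' => h ?_
    exact (show pattern a b (ω (e none)).2 = W from hω.1.2).symm.trans hω'.1.2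

/-- Markov's inequality for the number of transmissions in the local rounds `(a, b]`. -/
lemma le_sum_real_transmitsAt (ν : Measure Schedule) [IsProbabilityMeasure ν] (a b x : ℕ) :
    (x + 1 : ℝ) * (1 - ν.real {s | (pattern a b s).card ≤ x}) ≤
      ∑ i ∈ Finset.Ioc a b, ν.real (transmitsAt i) := by
  have hi : ∀ i, Integrable ((transmitsAt i).indicator (1 : Schedule → ℝ)) ν := fun i =>
    (integrable_const (1 : ℝ)).indicator (measurableSet_transmitsAt i)
  have h1 : ∑ i ∈ Finset.Ioc a b, ν.real (transmitsAt i) =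
      ∫ s, ((pattern a b s).card : ℝ) ∂ν := by
    have : ∀ s, ((pattern a b s).card : ℝ) =
        ∑ i ∈ Finset.Ioc a b, (transmitsAt i).indicator (1 : Schedule → ℝ) s := by
      intro s
      simp [pattern, Set.indicator_apply, transmitsAt, Finset.sum_boole]
    simp only [this]
    rw [integral_finsetSum _ fun i _ => hi i]
    exact Finset.sum_congr rfl fun i _ => (integral_indicator_one (measurableSet_transmitsAt i)).symm
  have h2 : Integrable (fun s => ((pattern a b s).card : ℝ)) ν := by
    have : (fun s => ((pattern a b s).card : ℝ)) = fun s =>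
        ∑ i ∈ Finset.Ioc a b, (transmitsAt i).indicator (1 : Schedule → ℝ) s := by
      ext s
      simp [pattern, Set.indicator_apply, transmitsAt, Finset.sum_boole]
    rw [this]
    exact integrable_finsetSum _ fun i _ => hi i
  have h3 := mul_meas_ge_le_integral_of_nonneg (μ := ν)
    (Eventually.of_forall fun s => Nat.cast_nonneg _) h2 ((x : ℝ) + 1)
  rw [h1, ← probReal_compl_eq_one_sub (measurableSet_card_pattern_le a b x)]
  convert h3 using 3
  ext s
  simp only [Set.mem_compl_iff, Set.mem_ofPred_eq, not_le]
  exact_mod_cast Nat.lt_iff_add_one_le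

/-! ### A steady load jams every round. -/

lemma transmitters_ne_singleton_of_hits {n m : ℕ} {Γ : Type*} {e : Option (Γ × Fin m) ↪ Fin n} {g g' : Γ}
    (hg : g ≠ g') {ω : Fin n → ℕ × Schedule} {t : ℕ} (h : ω ∈ hits (group e g) (scheduledAt t))
    (h' : ω ∈ hits (group e g') (scheduledAt t)) (w : Fin n) :
    transmitters (fun u => (ω u).1) (fun u => (ω u).2) Set.univ t ≠ {w} := by
  intro hw
  obtain ⟨u, hu, hut⟩ := h
  obtain ⟨u', hu', hut'⟩ := h'
  have h1 : u ∈ transmitters (fun u => (ω u).1) (fun u => (ω u).2) Set.univ t :=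
    ⟨Set.mem_univ u, hut.1, hut.2⟩
  have h2 : u' ∈ transmitters (fun u => (ω u).1) (fun u => (ω u).2) Set.univ t :=
    ⟨Set.mem_univ u', hut'.1, hut'.2⟩
  rw [hw, Set.mem_singleton_iff] at h1 h2
  subst h1
  subst h2
  exact Finset.disjoint_left.1 (disjoint_group e hg) hu hu'

/-- The first `N` rounds are jammed by two groups of `m` stations spread over these rounds, and the
rounds up to `T` by two groups spread over all rounds. -/
lemma one_sub_le_of_steady_load (A : NonAdaptiveAlgorithm) {n m N T r : ℕ} {δ : ℝ}
    (hr : 1 ≤ r)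
    (h0 : ∀ j, 1 ≤ j → j < r → (A.law : Measure Schedule).real (transmitsAt j) = 0)
    (hN : 1 ≤ N) (hNT : N ≤ T) (hn : 4 * m + 1 ≤ n)
    (hA : ∀ act : Fin n → ℕ, 1 - δ ≤ A.probLatencyLE act T) :
    1 - (2 * N * Real.exp (-((1 / N * (A.law : Measure Schedule).real (transmitsAt r)) * m)) +
      2 * T * Real.exp (-((1 / T * ∑ i ∈ Finset.Ioc 0 N,
        (A.law : Measure Schedule).real (transmitsAt i)) * m))) ≤ δ := by
  classical
  set ν : Measure Schedule := (A.law : Measure Schedule) with hν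
  set p := ν.real (transmitsAt r)
  set load := ∑ i ∈ Finset.Ioc 0 N, ν.real (transmitsAt i)
  -- The first flag selects the activation window; the second doubles each group, to produce two
  -- distinct transmitters.
  obtain ⟨e⟩ := exists_embedding_groups (Γ := Bool × Bool) (m := m) (n := n) (by simpa using hn)
  have fN : Fact (Finset.range N).Nonempty := ⟨by simp; omega⟩
  have fT : Fact (Finset.range T).Nonempty := ⟨by simp; omega⟩
  let L : Bool × Bool → Measure ℕ := fun o =>
    bif o.1 then uniformOn (Finset.range T : Finset ℕ) else uniformOn (Finset.range N : Finset ℕ)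
  have hL : ∀ g, IsProbabilityMeasure (L g) := by
    rintro ⟨_ | _, c⟩
    · exact inferInstanceAs (IsProbabilityMeasure (uniformOn ((Finset.range N : Finset ℕ) : Set ℕ)))
    · exact inferInstanceAs (IsProbabilityMeasure (uniformOn ((Finset.range T : Finset ℕ) : Set ℕ)))
  let U := activationLaw e 0 L
  have hU : ∀ u, IsProbabilityMeasure (U u) := fun u =>
    inferInstanceAs (IsProbabilityMeasure (activationLaw e 0 L u))
  let μ : Fin n → Measure (ℕ × Schedule) := fun u => (U u).prod ν
  set P := Measure.pi μ with hP
  have mhits : ∀ g t, MeasurableSet (hits (group e g) (scheduledAt t)) := fun g t =>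
    measurableSet_hits _ (measurableSet_scheduledAt t)
  have early : ∀ c, ∀ t ∈ Finset.Icc r N, P.real (hits (group e (false, c)) (scheduledAt t))ᶜ ≤
      Real.exp (-((1 / N * p) * m)) := by
    intro c t ht
    rw [Finset.mem_Icc] at ht
    have := pi_real_compl_hits_le μ (group e (false, c)) (measurableSet_scheduledAt t)
      (q := 1 / N * p) (fun u hu => by
        simp only [μ]
        rw [show U u = L (false, c) from activationLaw_group e 0 L hu, prod_real_scheduledAt]
        -- Only activation in round `t - r` is counted.
        refine le_trans (le_of_eq ?_) (Finset.single_le_sum (f := fun a =>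
          (L (false, c)).real {a} * ν.real (transmitsAt (t - a))) (fun a _ => by positivity)
          (Finset.mem_range.2 (show t - r < t by omega)))
        simp only [L, cond_false]
        rw [uniformOn_real_singleton (Finset.mem_range.2 (by omega)),
          show t - (t - r) = r by omega]
        simp [p])
    rwa [card_group] at this
  have late : ∀ c, ∀ t ∈ Finset.Ioc N T, P.real (hits (group e (true, c)) (scheduledAt t))ᶜ ≤
      Real.exp (-((1 / T * load) * m)) := by
    intro c t ht
    rw [Finset.mem_Ioc] at ht
    have := pi_real_compl_hits_le μ (group e (true, c)) (measurableSet_scheduledAt t)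
      (q := 1 / T * load) (fun u hu => by
        simp only [μ]
        rw [show U u = L (true, c) from activationLaw_group e 0 L hu, prod_real_scheduledAt]
        have h1 : ∀ a ∈ Finset.range t, (L (true, c)).real {a} * ν.real (transmitsAt (t - a)) =
            1 / T * ν.real (transmitsAt (t - a)) := by
          intro a hat
          simp only [L, cond_true]
          rw [Finset.mem_range] at hat
          rw [uniformOn_real_singleton (Finset.mem_range.2 (by omega))]
          simp
        rw [Finset.sum_congr rfl h1, ← Finset.mul_sum]
        refine mul_le_mul_of_nonneg_left ?_ (by positivity)
        -- Since `t > N`, activations in rounds before `t` cover all local rounds up to `N`.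
        calc load ≤ ∑ i ∈ Finset.Ioc 0 t, ν.real (transmitsAt i) :=
              Finset.sum_le_sum_of_subset_of_nonneg
                (Finset.Ioc_subset_Ioc_right (by omega)) fun _ _ _ => measureReal_nonneg
          _ = ∑ a ∈ Finset.range t, ν.real (transmitsAt (t - a)) := by
              refine Finset.sum_nbij' (fun i => t - i) (fun a => t - a) ?_ ?_ ?_ ?_ ?_
              · intro i hi; rw [Finset.mem_Ioc] at hi; exact Finset.mem_range.2 (by omega)
              · intro a ha; rw [Finset.mem_range] at ha; exact Finset.mem_Ioc.2 (by omega)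
              · intro i hi; rw [Finset.mem_Ioc] at hi; omega
              · intro a ha; rw [Finset.mem_range] at ha; omega
              · intro i hi
                rw [Finset.mem_Ioc] at hi
                rw [show t - (t - i) = i by omega])
    rwa [card_group] at this
  let G : Set (Fin n → ℕ × Schedule) :=
    (⋂ t ∈ Finset.Icc r N, ⋂ c ∈ (Finset.univ : Finset Bool),
      hits (group e (false, c)) (scheduledAt t)) ∩
    ⋂ t ∈ Finset.Ioc N T, ⋂ c ∈ (Finset.univ : Finset Bool),
      hits (group e (true, c)) (scheduledAt t)
  have mG : MeasurableSet G :=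
    (Finset.measurableSet_biInter _ fun t _ => Finset.measurableSet_biInter _ fun c _ =>
      mhits _ t).inter
    (Finset.measurableSet_biInter _ fun t _ => Finset.measurableSet_biInter _ fun c _ =>
      mhits _ t)
  have union_bound : ∀ (s : Finset ℕ) (b : Bool) (q : ℝ),
      (∀ c, ∀ t ∈ s, P.real (hits (group e (b, c)) (scheduledAt t))ᶜ ≤ q) →
      P.real (⋂ t ∈ s, ⋂ c ∈ (Finset.univ : Finset Bool),
        hits (group e (b, c)) (scheduledAt t))ᶜ ≤ 2 * s.card * q := by
    intro s b q hq
    simp only [Set.compl_iInter]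
    calc _ ≤ ∑ t ∈ s, P.real (⋃ c ∈ (Finset.univ : Finset Bool),
          (hits (group e (b, c)) (scheduledAt t))ᶜ) := measureReal_biUnion_finset_le _ _
      _ ≤ ∑ t ∈ s, ∑ c ∈ (Finset.univ : Finset Bool),
          P.real (hits (group e (b, c)) (scheduledAt t))ᶜ :=
        Finset.sum_le_sum fun t _ => measureReal_biUnion_finset_le _ _
      _ ≤ ∑ t ∈ s, ∑ c ∈ (Finset.univ : Finset Bool), q :=
        Finset.sum_le_sum fun t ht => Finset.sum_le_sum fun c _ => hq c t ht
      _ = 2 * s.card * q := by simp; ring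
  have pG : 1 - (2 * N * Real.exp (-((1 / N * p) * m)) +
      2 * T * Real.exp (-((1 / T * load) * m))) ≤ P.real G := by
    have h1 := union_bound (Finset.Icc r N) false _ early
    have h2 := union_bound (Finset.Ioc N T) true _ late
    have h3 := measureReal_union_le (μ := P)
      (⋂ t ∈ Finset.Icc r N, ⋂ c ∈ (Finset.univ : Finset Bool),
        hits (group e (false, c)) (scheduledAt t))ᶜ
      (⋂ t ∈ Finset.Ioc N T, ⋂ c ∈ (Finset.univ : Finset Bool),
        hits (group e (true, c)) (scheduledAt t))ᶜ
    rw [← Set.compl_inter] at h3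
    change P.real Gᶜ ≤ _ at h3
    rw [probReal_compl_eq_one_sub mG] at h3
    have h4 : 2 * ((Finset.Icc r N).card : ℝ) * Real.exp (-((1 / N * p) * m)) ≤
        2 * N * Real.exp (-((1 / N * p) * m)) := by
      gcongr
      rw [Nat.card_Icc]; omega
    have h5 : 2 * ((Finset.Ioc N T).card : ℝ) * Real.exp (-((1 / T * load) * m)) ≤
        2 * T * Real.exp (-((1 / T * load) * m)) := by
      gcongr
      rw [Nat.card_Ioc]; omega
    linarith
  -- An almost sure event. Its second half keeps reference rounds before `r` silent, where the early
  -- groups guarantee nothing.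
  let H : Set (Fin n → ℕ × Schedule) := {ω | (ω (e none)).1 = 0} ∩
    ⋂ u, ⋂ j ∈ Finset.Ico 1 r, {ω | (ω u).2 ∈ (transmitsAt j)ᶜ}
  have mH : MeasurableSet H := by
    refine MeasurableSet.inter ?_ (MeasurableSet.iInter fun u =>
      Finset.measurableSet_biInter _ fun j _ => ?_)
    · exact measurableSet_preimage (f := fun ω : Fin n → ℕ × Schedule => (ω (e none)).1)
        (by fun_prop) (MeasurableSet.singleton 0)
    · exact measurableSet_preimage (f := fun ω : Fin n → ℕ × Schedule => (ω u).2)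
        (by fun_prop) (measurableSet_transmitsAt j).compl
  have aeH : ∀ᵐ ω ∂P, ω ∈ H := by
    have h1 : ∀ᵐ ω ∂P, (ω (e none)).1 = 0 := by
      have hq : MeasurePreserving (fun ω : Fin n → ℕ × Schedule => (ω (e none)).1) P
          (U (e none)) :=
        (measurePreserving_fst (μ := U (e none)) (ν := ν)).comp (measurePreserving_eval μ (e none))
      refine hq.quasiMeasurePreserving.ae (p := fun a => a = 0) ?_
      rw [show U (e none) = Measure.dirac 0 from activationLaw_none e 0 L]
      simp [ae_dirac_eq]
    have h2 : ∀ᵐ ω ∂P, ∀ u, ∀ j ∈ Finset.Ico 1 r, (ω u).2 ∈ (transmitsAt j)ᶜ := by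
      rw [ae_all_iff]
      intro u
      rw [Finset.eventually_all]
      intro j hj
      rw [Finset.mem_Ico] at hj
      have hq : MeasurePreserving (fun ω : Fin n → ℕ × Schedule => (ω u).2) P ν :=
        (measurePreserving_snd (μ := U u) (ν := ν)).comp (measurePreserving_eval μ u)
      refine hq.quasiMeasurePreserving.ae (p := fun s => s ∈ (transmitsAt j)ᶜ) ?_
      exact measure_eq_zero_iff_ae_notMem.mp ((measureReal_eq_zero_iff).1 (h0 j hj.1 hj.2))
    filter_upwards [h1, h2] with ω hω1 hω2
    exact ⟨hω1, by simpa only [Set.mem_iInter, Set.mem_ofPred_eq] using hω2⟩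
  have hGH : P.real (G ∩ H) = P.real G := by
    refine measureReal_congr ?_
    filter_upwards [aeH] with ω hω
    exact propext ⟨fun h => h.1, fun h => ⟨h, hω⟩⟩
  refine (pG.trans hGH.ge).trans (pi_real_le_of_forall_latency hA U (mG.inter mH) ?_)
  rintro ω ⟨⟨hωe, hωl⟩, hω0, hωs⟩
  simp only [Set.mem_iInter] at hωe hωl hωs
  refine lt_latency_of_no_singleton (v := e none) hω0 fun t ht1 htT w => ?_
  rcases lt_or_ge N t with hNt | hNt
  · have := hωl t (Finset.mem_Ioc.2 ⟨hNt, htT⟩)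
    exact transmitters_ne_singleton_of_hits (g := (true, false)) (g' := (true, true)) (by simp)
      (this _ (Finset.mem_univ _)) (this _ (Finset.mem_univ _)) w
  rcases lt_or_ge t r with htr | htr
  · intro hw
    have hmem : w ∈ transmitters (fun u => (ω u).1) (fun u => (ω u).2) Set.univ t := by
      rw [hw]; rfl
    have h1 : (ω w).1 < t := hmem.2.1
    exact hωs w (t - (ω w).1) (Finset.mem_Ico.2 (by omega)) hmem.2.2
  · have := hωe t (Finset.mem_Icc.2 ⟨htr, hNt⟩)
    exact transmitters_ne_singleton_of_hits (g := (false, false)) (g' := (false, true)) (by simp)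
      (this _ (Finset.mem_univ _)) (this _ (Finset.mem_univ _)) w

/-- A reliable algorithm transmits in some local round with positive probability. -/
lemma exists_real_transmitsAt_pos (A : NonAdaptiveAlgorithm) {n M : ℕ} {δ : ℝ} (hn : 1 ≤ n)
    (hδ : δ < 1) (hA : ∀ act : Fin n → ℕ, 1 - δ ≤ A.probLatencyLE act M) :
    ∃ r, 1 ≤ r ∧ 0 < (A.law : Measure Schedule).real (transmitsAt r) := by
  by_contra! hcon
  let U : Fin n → Measure ℕ := fun _ => Measure.dirac 0
  let μ : Fin n → Measure (ℕ × Schedule) := fun u => (U u).prod (A.law : Measure Schedule)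
  let H : Set (Fin n → ℕ × Schedule) :=
    ⋂ u, ⋂ j ∈ Set.Ici 1, {ω | (ω u).2 ∈ (transmitsAt j)ᶜ}
  have mH : MeasurableSet H := MeasurableSet.iInter fun u =>
    MeasurableSet.biInter (Set.to_countable _) fun j _ =>
      measurableSet_preimage (f := fun ω : Fin n → ℕ × Schedule => (ω u).2)
        (by fun_prop) (measurableSet_transmitsAt j).compl
  have aeH : ∀ᵐ ω ∂(Measure.pi μ), ω ∈ H := by
    simp only [H, Set.mem_iInter]
    rw [ae_all_iff]
    intro u
    rw [ae_ball_iff (Set.to_countable _)]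
    intro j hj
    have hq : MeasurePreserving (fun ω : Fin n → ℕ × Schedule => (ω u).2) (Measure.pi μ)
        (A.law : Measure Schedule) :=
      (measurePreserving_snd (μ := U u)).comp (measurePreserving_eval μ u)
    refine hq.quasiMeasurePreserving.ae (p := fun s => s ∈ (transmitsAt j)ᶜ) ?_
    exact measure_eq_zero_iff_ae_notMem.mp
      ((measureReal_eq_zero_iff).1 (le_antisymm (hcon j hj) measureReal_nonneg))
  have h1 : (Measure.pi μ).real H = 1 := by
    have hH : H =ᵐ[Measure.pi μ] Set.univ := eventuallyEq_univ.2 aeH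
    rw [measureReal_congr hH, probReal_univ]
  have h2 : (Measure.pi μ).real H ≤ δ := by
    refine pi_real_le_of_forall_latency hA U mH fun ω hω => ?_
    simp only [H, Set.mem_iInter] at hω
    refine lt_latency_of_forall_not_succeedsAt (v := ⟨0, hn⟩) fun t ht _ hs => ?_
    have hmem : (⟨0, hn⟩ : Fin n) ∈ transmitters (fun u => (ω u).1) (fun u => (ω u).2)
        (notYetSuccessful (fun u => (ω u).1) (fun u => (ω u).2) t) t := by
      rw [show transmitters _ _ (notYetSuccessful _ _ t) t = {_} from hs]; rfl
    exact hω _ (t - (ω ⟨0, hn⟩).1) (by simp only [Set.mem_Ici]; omega) hmem.2.2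
  linarith

/-! ### Calibration of the scales. -/

lemma probLatencyLE_mono (A : NonAdaptiveAlgorithm) {k : ℕ} (act : Fin k → ℕ) {m m' : ℕ}
    (h : m ≤ m') : A.probLatencyLE act m ≤ A.probLatencyLE act m' :=
  measureReal_mono fun S (hS : latency act S ≤ m) => show latency act S ≤ m' from
    hS.trans (by exact_mod_cast h)

lemma natCast_pow_eq_exp {J : ℕ} (hJ : 0 < J) (k : ℕ) :
    (J : ℝ) ^ k = Real.exp (k * Real.log J) := by
  rw [Real.exp_nat_mul, Real.exp_log (by exact_mod_cast hJ)]

lemma half_le_one_sub_exp_neg {y : ℝ} (h0 : 0 ≤ y) (h1 : y ≤ 1) : y / 2 ≤ 1 - Real.exp (-y) := by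
  have h2 : Real.exp (-y) ≤ 1 / (1 + y) := by
    rw [Real.exp_neg, ← one_div]
    exact one_div_le_one_div_of_le (by linarith) (by linarith [Real.add_one_le_exp y])
  have h3 : 1 / (1 + y) ≤ 1 - y / 2 := by
    rw [div_le_iff₀ (by linarith)]
    nlinarith
  linarith

lemma exp_neg_three_le : Real.exp (-3) ≤ 1 / 16 := by
  rw [Real.exp_neg, ← one_div]
  refine one_div_le_one_div_of_le (by norm_num) ?_
  have h1 := Real.exp_one_gt_d9
  have h2 : Real.exp 3 = Real.exp 1 ^ 3 := by rw [← Real.exp_nat_mul]; norm_num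
  rw [h2]
  calc (16 : ℝ) ≤ 2.7 ^ 3 := by norm_num
    _ ≤ _ := by gcongr; linarith

lemma one_div_rpow_le_exp {J k : ℕ} (hJ : 2 ≤ J) {η : ℝ} (hη : 0 < η) (hk : 8 * J ≤ k) :
    1 / ((J ^ k : ℕ) : ℝ) ^ η ≤ Real.exp (-(8 * η * J * Real.log J)) := by
  have hl : 0 ≤ Real.log J := Real.log_natCast_nonneg J
  rw [Nat.cast_pow, natCast_pow_eq_exp (by omega), ← Real.exp_mul, one_div, ← Real.exp_neg,
    Real.exp_le_exp]
  have : (8 * J : ℝ) ≤ k := by exact_mod_cast hk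
  have := mul_le_mul_of_nonneg_right this (mul_nonneg hl hη.le)
  linarith

/-- The expected number of transmissions between two scales: an algorithm that is reliable for
contention size `J ^ (8 * j)` transmits `Ω(J)` times within the local rounds from
`J ^ (8 * j - 4)` to `J ^ (8 * j + 4)`. -/
lemma le_sum_transmitsAt_of_reliable (A : NonAdaptiveAlgorithm) {J j r : ℕ} {η p : ℝ}
    (hJ : 4 ≤ J) (hjJ : J ≤ j) (hj : j < 2 * J) (hη : 0 < η) (hη1 : η ≤ 1) (hr : 1 ≤ r)
    (hp : (A.law : Measure Schedule).real (firstAt r) = p)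
    (h1 : 16 * J * Real.log J + 3 ≤ p * J ^ 2) (h2 : 2 ≤ p * J) (h3 : 1 ≤ η * J * Real.log J)
    (hA : ∀ act : Fin (J ^ (8 * j)) → ℕ,
      1 - 1 / ((J ^ (8 * j) : ℕ) : ℝ) ^ η ≤ A.probLatencyLE act (J ^ (8 * j + 2))) :
    η * J / 10 ≤ ∑ i ∈ Finset.Ioc (J ^ (8 * j - 4)) (J ^ (8 * (j + 1) - 4)),
      (A.law : Measure Schedule).real (transmitsAt i) := by
  have hJ0 : (0 : ℝ) < J := by exact_mod_cast (by omega : 0 < J)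
  have hJ4 : (4 : ℝ) ≤ J := by exact_mod_cast hJ
  have hl : 0 ≤ Real.log J := Real.log_natCast_nonneg J
  have hp1 : p ≤ 1 := hp ▸ measureReal_le_one
  have hp0 : 0 < p := by
    by_contra! h
    nlinarith
  -- A late jam costs a factor of at most `J ^ 5`, so `x` of them cost at most `exp (η * J * log
  -- J)`, well below the reliability `exp (8 * η * J * log J)`.
  set x := ⌊η * J / 5⌋₊ with hx
  have hxle : (x : ℝ) ≤ η * J / 5 := Nat.floor_le (by positivity)
  have hxlt : η * J / 5 < x + 1 := Nat.lt_floor_add_one _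
  have hxJ : x + 1 ≤ J := by
    have : (x : ℝ) + 1 ≤ J := by nlinarith
    exact_mod_cast this
  have hn : (x + 1) * J ^ (8 * j - 2) + 1 ≤ J ^ (8 * j) := by
    calc (x + 1) * J ^ (8 * j - 2) + 1 ≤ J * J ^ (8 * j - 2) + J * J ^ (8 * j - 2) :=
          add_le_add (Nat.mul_le_mul_right _ hxJ)
            (Nat.mul_pos (by omega) (Nat.pow_pos (by omega)))
      _ = 2 * (J * J ^ (8 * j - 2)) := by ring
      _ ≤ J * (J * J ^ (8 * j - 2)) := Nat.mul_le_mul_right _ (by omega)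
      _ = J ^ (8 * j) := by
          rw [← pow_succ', ← pow_succ']; congr 1; omega
  have key := real_card_pattern_le_mul_le A (a := J ^ (8 * j - 4)) (b := J ^ (8 * j + 2)) hr
    (Nat.one_le_pow _ _ (by omega)) (Nat.one_le_pow _ _ (by omega)) hn hA
  rw [hp] at key
  set Z := (A.law : Measure Schedule).real
    {s | (pattern (J ^ (8 * j - 4)) (J ^ (8 * j + 2)) s).card ≤ x} with hZ
  have hZ0 : 0 ≤ Z := measureReal_nonneg
  -- With `m = J ^ (8 * j - 2)`, the expected number of fresh jammers per round is `p * J ^ 2` from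
  -- the early group and `p / J ^ 4` from a late one.
  have e1 : 1 / ((J ^ (8 * j - 4) : ℕ) : ℝ) * p * ((J ^ (8 * j - 2) : ℕ) : ℝ) = p * J ^ 2 := by
    have : 8 * j - 2 = (8 * j - 4) + 2 := by omega
    rw [this, pow_add]
    push_cast
    field_simp
  have e2 : 1 / ((J ^ (8 * j + 2) : ℕ) : ℝ) * p * ((J ^ (8 * j - 2) : ℕ) : ℝ) = p / J ^ 4 := by
    have : 8 * j + 2 = (8 * j - 2) + 4 := by omega
    rw [this, pow_add]
    push_cast
    field_simp
  rw [e1, e2] at key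
  have f1 : (1 : ℝ) / 2 ≤ 1 - ((J ^ (8 * j - 4) : ℕ) : ℝ) * Real.exp (-(p * J ^ 2)) := by
    have : ((J ^ (8 * j - 4) : ℕ) : ℝ) * Real.exp (-(p * J ^ 2)) ≤ Real.exp (-3) := by
      rw [Nat.cast_pow, natCast_pow_eq_exp (by omega), ← Real.exp_add, Real.exp_le_exp]
      have : ((8 * j - 4 : ℕ) : ℝ) ≤ 16 * J := by exact_mod_cast (by omega : 8 * j - 4 ≤ 16 * J)
      nlinarith
    linarith [exp_neg_three_le]
  have f2 : ((J : ℝ) ^ 5)⁻¹ ≤ 1 - Real.exp (-(p / J ^ 4)) := by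
    have h4 : p / J ^ 4 ≤ 1 := by
      rw [div_le_one (by positivity)]
      exact hp1.trans (one_le_pow₀ (by linarith))
    refine le_trans ?_ (half_le_one_sub_exp_neg (by positivity) h4)
    rw [inv_eq_one_div, div_div, div_le_div_iff₀ (by positivity) (by positivity)]
    nlinarith [pow_pos hJ0 4]
  have f3 : Real.exp (-(η * J * Real.log J)) ≤ (1 - Real.exp (-(p / J ^ 4))) ^ x := by
    refine le_trans ?_ (pow_le_pow_left₀ (by positivity) f2 x)
    rw [natCast_pow_eq_exp (J := J) (by omega) 5, ← Real.exp_neg, ← Real.exp_nat_mul, Real.exp_le_exp]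
    push_cast
    nlinarith [mul_le_mul_of_nonneg_right hxle hl]
  have f4 := one_div_rpow_le_exp (J := J) (k := 8 * j) (by omega) hη (by omega)
  have f5 : Z * (1 / 2) * Real.exp (-(η * J * Real.log J)) ≤
      Real.exp (-(8 * η * J * Real.log J)) :=
    le_trans (by gcongr) (key.trans f4)
  have f6 : Z ≤ 1 / 2 := by
    have : Real.exp (-(8 * η * J * Real.log J)) =
        Real.exp (-(7 * (η * J * Real.log J))) * Real.exp (-(η * J * Real.log J)) := by
      rw [← Real.exp_add]; congr 1; ring
    rw [this] at f5
    have h7 := le_of_mul_le_mul_right f5 (Real.exp_pos _)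
    have h8 : Real.exp (-(7 * (η * J * Real.log J))) ≤ Real.exp (-3) :=
      Real.exp_le_exp.2 (by linarith)
    linarith [exp_neg_three_le]
  have markov := le_sum_real_transmitsAt (A.law : Measure Schedule) (J ^ (8 * j - 4))
    (J ^ (8 * j + 2)) x
  rw [← hZ] at markov
  calc η * J / 10 ≤ (x + 1) * (1 - Z) := by nlinarith
    _ ≤ _ := markov
    _ ≤ _ := Finset.sum_le_sum_of_subset_of_nonneg
        (Finset.Ioc_subset_Ioc_right (Nat.pow_le_pow_right (by omega) (by omega)))
        fun _ _ _ => measureReal_nonneg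

/-- The counterpart of `le_sum_transmitsAt_of_reliable` for many scales. -/
lemma le_sum_of_scales {f : ℕ → ℝ} (hf : ∀ i, 0 ≤ f i) {J : ℕ} {c : ℝ} (hJ : 1 ≤ J)
    (h : ∀ j, J ≤ j → j < 2 * J →
      c ≤ ∑ i ∈ Finset.Ioc (J ^ (8 * j - 4)) (J ^ (8 * (j + 1) - 4)), f i) :
    J * c ≤ ∑ i ∈ Finset.Ioc 0 (J ^ (16 * J - 4)), f i := by
  have key : ∀ d ≤ J, d * c ≤
      ∑ i ∈ Finset.Ioc (J ^ (8 * J - 4)) (J ^ (8 * (J + d) - 4)), f i := by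
    intro d
    induction d with
    | zero => simp
    | succ d ih =>
      intro hd
      have h1 := ih (by omega)
      have h2 := h (J + d) (by omega) (by omega)
      -- The scale intervals are adjacent, so their sums concatenate.
      rw [← Finset.sum_Ioc_consecutive f (n := J ^ (8 * (J + d) - 4))
        (Nat.pow_le_pow_right hJ (by omega)) (Nat.pow_le_pow_right hJ (by omega))]
      push_cast
      rw [show J + (d + 1) = J + d + 1 by ring]
      linarith
  refine (key J le_rfl).trans ?_
  rw [show 8 * (J + J) = 16 * J by ring]
  exact Finset.sum_le_sum_of_subset_of_nonneg (Finset.Ioc_subset_Ioc_left (Nat.zero_le _))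
    fun _ _ _ => hf _

/-- Contradiction for one large value of the scale parameter `J`. -/
lemma not_reliable_of_scale (A : NonAdaptiveAlgorithm) {J r T : ℕ} {η p : ℝ}
    (hJ : 4 ≤ J) (hη : 0 < η) (hη1 : η ≤ 1) (hr : 1 ≤ r)
    (h0 : ∀ j, 1 ≤ j → j < r → (A.law : Measure Schedule).real (transmitsAt j) = 0)
    (hp : (A.law : Measure Schedule).real (transmitsAt r) = p)
    (hlog : 1 ≤ Real.log J)
    (h1 : 16 * J * Real.log J + 3 ≤ p * J ^ 2) (h2 : 2 ≤ p * J) (h3 : 1 ≤ η * J * Real.log J)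
    (hA : ∀ j, J ≤ j → j < 2 * J → ∀ act : Fin (J ^ (8 * j)) → ℕ,
      1 - 1 / ((J ^ (8 * j) : ℕ) : ℝ) ^ η ≤ A.probLatencyLE act (J ^ (8 * j + 2)))
    (hnT : J ^ (16 * J) ≤ T) (hT2 : T ≤ J ^ (16 * J + 2))
    (hT : (T : ℝ) * Real.log J ≤ η / 3200 * J * (J : ℝ) ^ (16 * J))
    (hAT : ∀ act : Fin (J ^ (16 * J)) → ℕ,
      1 - 1 / ((J ^ (16 * J) : ℕ) : ℝ) ^ η ≤ A.probLatencyLE act T) : False := by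
  have hJ0 : (0 : ℝ) < J := by exact_mod_cast (by omega : 0 < J)
  have hJ4 : (4 : ℝ) ≤ J := by exact_mod_cast hJ
  have hp0 : 0 < p := by
    by_contra! h
    nlinarith
  have hpf : (A.law : Measure Schedule).real (firstAt r) = p := by
    rw [real_firstAt_eq _ h0, hp]
  set load := ∑ i ∈ Finset.Ioc 0 (J ^ (16 * J - 4)), (A.law : Measure Schedule).real (transmitsAt i)
    with hload
  have hS : J * (η * J / 10) ≤ load :=
    le_sum_of_scales (fun _ => measureReal_nonneg) (by omega) fun j hj1 hj2 =>
      le_sum_transmitsAt_of_reliable A hJ hj1 hj2 hη hη1 hr hpf h1 h2 h3 (hA j hj1 hj2)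
  set n := J ^ (16 * J) with hn
  have hn64 : 16 ≤ n := by
    calc 16 = 4 ^ 2 := by norm_num
      _ ≤ J ^ 2 := Nat.pow_le_pow_left hJ 2
      _ ≤ n := Nat.pow_le_pow_right (by omega) (by omega)
  have hm16 : (n : ℝ) / 16 ≤ ((n / 8 : ℕ) : ℝ) := by
    have : n ≤ 16 * (n / 8) := by omega
    have : (n : ℝ) ≤ 16 * ((n / 8 : ℕ) : ℝ) := by exact_mod_cast this
    linarith
  have hN : J ^ (16 * J - 4) ≤ n := Nat.pow_le_pow_right (by omega) (by omega)
  have key := one_sub_le_of_steady_load A (m := n / 8) hr h0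
    (Nat.one_le_pow (16 * J - 4) J (by omega)) (hN.trans hnT) (by omega) hAT
  rw [hp, ← hload] at key
  have hnR : (n : ℝ) = (J : ℝ) ^ (16 * J) := by rw [hn]; push_cast; rfl
  have hn0 : (0 : ℝ) < n := by rw [hnR]; positivity
  have hT0 : (0 : ℝ) < T := lt_of_lt_of_le hn0 (by exact_mod_cast hnT)
  have hδ := one_div_rpow_le_exp (J := J) (k := 16 * J) (by omega) hη (by omega)
  have hδ' : Real.exp (-(8 * η * J * Real.log J)) ≤ Real.exp (-3) :=
    Real.exp_le_exp.2 (by linarith)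
  have g1 : ((J ^ (16 * J - 4) : ℕ) : ℝ) * Real.exp (-((1 / ((J ^ (16 * J - 4) : ℕ) : ℝ) * p) *
      ((n / 8 : ℕ) : ℝ))) ≤ Real.exp (-3) := by
    have a1 : p * J ^ 2 ≤ (1 / ((J ^ (16 * J - 4) : ℕ) : ℝ) * p) * ((n / 8 : ℕ) : ℝ) := by
      have a2 : (n : ℝ) = (J : ℝ) ^ (16 * J - 4) * J ^ 4 := by
        rw [hnR, ← pow_add]; congr 1; omega
      calc p * J ^ 2 ≤ p * (J ^ 4 / 16) := by
            gcongr
            have : (16 : ℝ) ≤ J ^ 2 := by nlinarith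
            nlinarith
        _ = (1 / ((J ^ (16 * J - 4) : ℕ) : ℝ) * p) * (n / 16) := by
            rw [a2]; push_cast; field_simp
        _ ≤ _ := by gcongr
    have a3 : ((J ^ (16 * J - 4) : ℕ) : ℝ) ≤ Real.exp (16 * J * Real.log J) := by
      have : ((J ^ (16 * J - 4) : ℕ) : ℝ) ≤ (n : ℝ) := by exact_mod_cast hN
      rw [hnR, natCast_pow_eq_exp (by omega)] at this
      simpa using this
    calc _ ≤ Real.exp (16 * J * Real.log J) * Real.exp (-(p * J ^ 2)) := by gcongr
      _ ≤ Real.exp (-3) := by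
        rw [← Real.exp_add, Real.exp_le_exp]; linarith
  -- The constant `3200 = 10 * 16 * 20` combines the load `η * J ^ 2 / 10`, the group size at least
  -- `n / 16`, and an exponent `20 * J * log J` that beats `log T ≤ (16 * J + 2) * log J`.
  have g2 : (T : ℝ) * Real.exp (-((1 / (T : ℝ) * load) * ((n / 8 : ℕ) : ℝ))) ≤ Real.exp (-3) := by
    have a1 : 20 * J * Real.log J ≤ (1 / (T : ℝ) * load) * ((n / 8 : ℕ) : ℝ) := by
      calc 20 * J * Real.log J ≤ (1 / (T : ℝ) * (J * (η * J / 10))) * (n / 16) := by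
            rw [show (1 / (T : ℝ) * (J * (η * J / 10))) * (n / 16) =
              (J * (η * J / 10) * n / 16) / T by ring, le_div_iff₀ hT0]
            have := mul_le_mul_of_nonneg_left hT (by positivity : (0 : ℝ) ≤ 20 * J)
            rw [hnR]
            nlinarith
        _ ≤ _ := by gcongr
    have a2 : (T : ℝ) ≤ Real.exp ((16 * J + 2) * Real.log J) := by
      have : (T : ℝ) ≤ ((J ^ (16 * J + 2) : ℕ) : ℝ) := by exact_mod_cast hT2
      rw [Nat.cast_pow, natCast_pow_eq_exp (by omega)] at this
      simpa using this
    calc _ ≤ Real.exp ((16 * J + 2) * Real.log J) * Real.exp (-(20 * J * Real.log J)) := by gcongr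
      _ ≤ Real.exp (-3) := by
        rw [← Real.exp_add, Real.exp_le_exp]; nlinarith
  have h16 := exp_neg_three_le
  linarith

end ContentionResolution

/-! ### Choice of a large scale parameter. -/

theorem theorem4p1 (η : ℝ) (hη : 0 < η) :
    ¬ ∃ (A : ContentionResolution.NonAdaptiveAlgorithm) (τ : ℕ → ℕ),
        (fun k : ℕ => (τ k : ℝ)) =o[atTop]
          (fun k : ℕ => (k : ℝ) * Real.log k / (Real.log (Real.log k)) ^ 2) ∧
        A.HasLatencyWhp η τ := by
  rintro ⟨A, τ, hτ, hA⟩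
  -- A smaller exponent only weakens reliability; the bound by `1` keeps the number of jamming
  -- groups at most `J`.
  set η' := min η 1 with hη'
  have hη0 : 0 < η' := lt_min hη one_pos
  have hη1 : η' ≤ 1 := min_le_right _ _
  have hA' : ∀ᶠ k : ℕ in atTop, ∀ m, τ k ≤ m → ∀ act : Fin k → ℕ,
      1 - 1 / (k : ℝ) ^ η' ≤ A.probLatencyLE act m := by
    filter_upwards [hA, eventually_ge_atTop 1] with k hk hk1 m hm act
    refine le_trans ?_ ((hk act).trans (ContentionResolution.probLatencyLE_mono A act hm))
    have hk1' : (1 : ℝ) ≤ k := by exact_mod_cast hk1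
    have := Real.rpow_le_rpow_of_exponent_le hk1' (min_le_left η 1)
    gcongr
  -- the first local round with a transmission
  obtain ⟨r, hr, hp, h0⟩ : ∃ r, 1 ≤ r ∧
      0 < (A.law : Measure ContentionResolution.Schedule).real
        (ContentionResolution.transmitsAt r) ∧
      ∀ j, 1 ≤ j → j < r → (A.law : Measure ContentionResolution.Schedule).real
        (ContentionResolution.transmitsAt j) = 0 := by
    classical
    obtain ⟨k, hk, hk2⟩ := (hA'.and (eventually_ge_atTop 2)).exists
    have hk2' : (1 : ℝ) < k := by exact_mod_cast (by omega : 1 < k)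
    have hδ : 1 / (k : ℝ) ^ η' < 1 := by
      rw [div_lt_one (by positivity)]
      exact Real.one_lt_rpow hk2' hη0
    have hex := ContentionResolution.exists_real_transmitsAt_pos A (by omega : 1 ≤ k) hδ
      (hk (τ k) le_rfl)
    refine ⟨Nat.find hex, (Nat.find_spec hex).1, (Nat.find_spec hex).2, fun j hj1 hj2 => ?_⟩
    have := Nat.find_min hex hj2
    push Not at this
    exact le_antisymm (this hj1) measureReal_nonneg
  set p := (A.law : Measure ContentionResolution.Schedule).real
    (ContentionResolution.transmitsAt r)
  -- Here `51200 = 16 * 3200`, the factor `16` coming from `log n = 16 * J * log J`.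
  set ε := η' / 51200 with hε
  have hε0 : 0 < ε := by positivity
  have hlim : Tendsto (fun k : ℕ => Real.log k) atTop atTop :=
    Real.tendsto_log_atTop.comp tendsto_natCast_atTop_atTop
  have hτ' : ∀ᶠ k : ℕ in atTop, 1 ≤ Real.log (Real.log k) ∧
      (τ k : ℝ) ≤ ε * (k * Real.log k / Real.log (Real.log k) ^ 2) := by
    filter_upwards [hτ.bound hε0,
      (Real.tendsto_log_atTop.comp hlim).eventually_ge_atTop 1] with k hk hk1
    refine ⟨hk1, ?_⟩
    rw [Real.norm_of_nonneg (Nat.cast_nonneg _), Real.norm_of_nonneg] at hk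
    · exact hk
    · exact div_nonneg (mul_nonneg (Nat.cast_nonneg _) (Real.log_natCast_nonneg k)) (sq_nonneg _)
  obtain ⟨k₀, hk₀⟩ := eventually_atTop.1 (hA'.and hτ')
  have hlogo : ∀ c : ℝ, 0 < c → ∀ᶠ J : ℕ in atTop, Real.log J ≤ c * J := by
    intro c hc
    filter_upwards [(Real.isLittleO_log_id_atTop.comp_tendsto
      tendsto_natCast_atTop_atTop).bound hc] with J hJ
    simp only [Function.comp, id, Real.norm_eq_abs, Nat.abs_cast] at hJ
    exact (le_abs_self _).trans hJ
  have hbig : ∀ c : ℝ, ∀ᶠ J : ℕ in atTop, c ≤ (J : ℝ) := fun c =>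
    tendsto_natCast_atTop_atTop.eventually_ge_atTop c
  obtain ⟨J, hJ4, hJk, hlog1, hJp, hJp2, hJη, hl1, hl2, hl3⟩ := ((eventually_ge_atTop 4).and
    ((eventually_ge_atTop k₀).and ((hlim.eventually_ge_atTop 1).and ((hbig (2 / p)).and
    ((hbig (6 / p)).and ((hbig (1 / η')).and ((hlogo (p / 32) (by positivity)).and
    ((hlogo (1 / 16) (by norm_num)).and (hlogo (16 * ε) (by positivity)))))))))).exists
  have hJ4R : (4 : ℝ) ≤ J := by exact_mod_cast hJ4
  have hJ0 : (0 : ℝ) < J := by linarith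
  have hlog0 : 0 < Real.log J := by linarith
  rw [div_le_iff₀ (by assumption)] at hJp hJp2 hJη
  have hpow : ∀ k, 1 ≤ k → k₀ ≤ J ^ k := fun k hk =>
    hJk.trans (Nat.le_self_pow (by omega) J)
  -- For the individual scales the crude bound `τ n ≤ n * log n ≤ n * J ^ 2` is enough; the sharp
  -- rate matters only at the top scale.
  have hτJ : ∀ j, 1 ≤ j → j ≤ 2 * J → τ (J ^ (8 * j)) ≤ J ^ (8 * j + 2) := by
    intro j hj1 hj2
    obtain ⟨-, hll, hle⟩ := hk₀ (J ^ (8 * j)) (hpow _ (by omega))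
    set n := J ^ (8 * j) with hn
    have hlogn : Real.log n = 8 * j * Real.log J := by
      rw [hn]; push_cast; rw [Real.log_pow]; push_cast; ring
    have hlogn0 : 0 ≤ Real.log n := Real.log_natCast_nonneg n
    have : (τ n : ℝ) ≤ ((J ^ (8 * j + 2) : ℕ) : ℝ) := by
      calc (τ n : ℝ) ≤ ε * (n * Real.log n / Real.log (Real.log n) ^ 2) := hle
        _ ≤ 1 * (n * Real.log n / 1) := by
            gcongr
            · rw [hε]; linarith
            · exact one_le_pow₀ hll
        _ = n * Real.log n := by ring
        _ ≤ n * J ^ 2 := by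
            gcongr
            have : (j : ℝ) ≤ 2 * J := by exact_mod_cast hj2
            rw [hlogn]
            nlinarith
        _ = _ := by rw [hn]; push_cast; ring
    exact_mod_cast this
  have hτn := hτJ (2 * J) (by omega) le_rfl
  rw [show 8 * (2 * J) = 16 * J by ring] at hτn
  obtain ⟨hAn, hll, hle⟩ := hk₀ (J ^ (16 * J)) (hpow _ (by omega))
  -- Raising the horizon to at least `n` preserves reliability and ensures that it contains the
  -- early window.
  refine ContentionResolution.not_reliable_of_scale A (T := max (τ (J ^ (16 * J))) (J ^ (16 * J)))
    hJ4 hη0 hη1 hr h0 rfl hlog1 ?_ ?_ ?_ ?_ (le_max_right _ _) ?_ ?_ (hAn _ (le_max_left _ _))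
  · nlinarith
  · linarith
  · nlinarith
  · intro j hj1 hj2
    exact (hk₀ _ (hpow _ (by omega))).1 _ (hτJ j (by omega) hj2.le)
  · exact max_le hτn (Nat.pow_le_pow_right (by omega) (by omega))
  · set n := J ^ (16 * J) with hn
    have hnR : (n : ℝ) = (J : ℝ) ^ (16 * J) := by rw [hn]; push_cast; rfl
    have hlogn : Real.log n = 16 * J * Real.log J := by rw [hnR, Real.log_pow]; push_cast; ring
    have hlogJ : Real.log J ≤ Real.log (Real.log n) := by
      refine Real.log_le_log hJ0 ?_
      rw [hlogn]; nlinarith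
    rw [← hnR, Nat.cast_max, max_mul_of_nonneg _ _ hlog0.le]
    have hεη : η' / 3200 = 16 * ε := by rw [hε]; ring
    rw [hεη]
    refine max_le ?_ ?_
    · calc (τ n : ℝ) * Real.log J ≤
            (ε * (n * Real.log n / Real.log (Real.log n) ^ 2)) * Real.log J := by gcongr
        _ ≤ (ε * (n * Real.log n / Real.log J ^ 2)) * Real.log J := by
            have : 0 ≤ Real.log n := Real.log_natCast_nonneg n
            gcongr
        _ = 16 * ε * J * n := by rw [hlogn]; field_simp
    · calc (n : ℝ) * Real.log J ≤ n * (16 * ε * J) := by gcongr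
        _ = _ := by ring
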